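/- Fix a deletion probability $p\in(0,1)$. For a finite binary string $s$, the circular deletion channel $\mathrm{Del}(s)$ is the distribution of the random string (a *trace*) obtained by deleting each bit of $s$ independently with probability $p$ and then applying a uniformly random cyclic shift to the remaining string. For an integer sequence $x=(x_1,\dots,x_k)$ and indices $i_1,\dots,i_m\in\{1,\dots,k\}$, the corresponding cyclic statistic of order $m$ is $$S_{i_1,\dots,i_m}(x)=\sum_{j=1}^{k}x_{i_1+j}\,x_{i_2+j}\cdots x_{i_m+j},$$ with indices read modulo $k$. An algorithm using $T$ traces is a (possibly randomized) map that receives $T$ independent samples of an unknown one of two distributions $\mu,\nu$ and names one of the two; it distinguishes $\mu$ from $\nu$ with probability $2/3$ if its answer is correct with probability at least $2/3$ when the samples come from $\mu$, and also when they come from $\nu$. **Lemma.** Let $p\in(0,1)$, $k\ge 1$, $z\ge 0$ and $M\ge 0$ be fixed ($k,z,M$ integers). There are constants $c>0$ and $N$, depending only on $p,k,z,M$, such that the following holds. Let $(x_1,\dots,x_k)$ and $(y_1,\dots,y_k)$ be integer sequences with entries of absolute value at most $M$ that are permutations of each other and have identical cyclic statistics of every order $m\le z$. For an integer $n\ge N$,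 let $$x^{(n)}=10^{n+x_1}10^{n+x_2}\cdots10^{n+x_k},\qquad y^{(n)}=10^{n+y_1}10^{n+y_2}\cdots10^{n+y_k}.$$ Then every algorithm that distinguishes $\mathrm{Del}(x^{(n)})$ from $\mathrm{Del}(y^{(n)})$ with probability $2/3$ uses at least $c\,n^{z+1}/\log^{z+1}n$ traces; that is, $\Omega\!\left(n^{z+1}/\log^{z+1}n\right)$ traces are required. -/

import Mathlib

namespace CircularTrace

/-- The `m`-th order cyclic statistic `S_{i₁,…,iₘ}(x) = ∑ⱼ x_{i₁+j} ⋯ x_{iₘ+j}` of an integer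
sequence of length `k`; addition in `Fin k` is addition modulo `k`. -/
def cyclicStat {k : ℕ} {m : ℕ} (i : Fin m → Fin k) (x : Fin k → ℤ) : ℤ :=
  ∑ j : Fin k, ∏ r : Fin m, x (i r + j)

/-- `x` and `y` have identical cyclic statistics up to order `z`. -/
def SameCyclicStats {k : ℕ} (z : ℕ) (x y : Fin k → ℤ) : Prop :=
  ∀ m : ℕ, m ≤ z → ∀ i : Fin m → Fin k, cyclicStat i x = cyclicStat i y

/-- The binary string `1 0^{a₁} 1 0^{a₂} … 1 0^{aₖ}` (`true` is the bit `1`). -/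
def gapString {k : ℕ} (a : Fin k → ℕ) : List Bool :=
  (List.ofFn fun j => true :: List.replicate (a j) false).flatten

/-- The binary string `1 0^{n+x₁} 1 0^{n+x₂} … 1 0^{n+xₖ}`, meaningful as soon as all the
gap lengths `n + xⱼ` are nonnegative, in particular for all large `n`. -/
def shiftedString {k : ℕ} (n : ℕ) (x : Fin k → ℤ) : List Bool :=
  gapString fun j => ((n : ℤ) + x j).toNat

/-- A coin that is `true` with probability `p`. -/
noncomputable def coin (p : unitInterval) : PMF Bool :=
  PMF.ofFintype (fun b => bif b then ENNReal.ofReal (p : ℝ) else ENNReal.ofReal (1 - (p : ℝ))) (by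
    rw [Fintype.sum_bool, cond_true, cond_false,
      ← ENNReal.ofReal_add p.2.1 (sub_nonneg.2 p.2.2), add_sub_cancel, ENNReal.ofReal_one])

/-- Delete each bit of a string independently with probability `p`. -/
noncomputable def deleteBits (p : unitInterval) : List Bool → PMF (List Bool)
  | [] => PMF.pure []
  | b :: l => (coin p).bind fun deleted =>
      (deleteBits p l).map fun l' => bif deleted then l' else b :: l'

/-- A uniformly random cyclic shift of a string. -/
noncomputable def randomShift : List Bool → PMF (List Bool)
  | [] => PMF.pure []
  | b :: l => (PMF.uniformOfFintype (Fin (l.length + 1))).map fun s => (b :: l).rotate s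

/-- The circular deletion channel: the law of a trace of the string `s`. -/
noncomputable def Del (p : unitInterval) (s : List Bool) : PMF (List Bool) :=
  (deleteBits p s).bind randomShift

/-- The law of `T` independent samples from `μ`. -/
noncomputable def iid {α : Type} (μ : PMF α) : (T : ℕ) → PMF (Fin T → α)
  | 0 => PMF.pure Fin.elim0
  | T + 1 => μ.bind fun a => (iid μ T).map fun s => Fin.cons a s

/-- A (randomized) algorithm that reads `T` traces and answers `true` ("the first distribution")
or `false` ("the second distribution"). -/
abbrev Algorithm (T : ℕ) : Type := (Fin T → List Bool) → PMF Bool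

/-- The algorithm `A`, run on `T` independent samples of an unknown one of the two distributions
`μ`, `ν`, answers correctly with probability at least `2/3`, whichever of the two it is. -/
def Distinguishes {T : ℕ} (A : Algorithm T) (μ ν : PMF (List Bool)) : Prop :=
  2 / 3 ≤ ((iid μ T).bind A) true ∧ 2 / 3 ≤ ((iid ν T).bind A) false

end CircularTrace

/-! Deletions are independent, so a trace arises by deleting the zeros first, then the ones, then
shifting. The trace law ignores rotations of the gap sequence, so a random starting one may be
inserted; the trace is then the image, under a channel independent of the gaps, of the surviving gap
vector read from that one (`Del_gapString`). An algorithm given these gap vectors can simulate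
traces, so it suffices to bound below the samples needed to tell two gap laws apart.

The gap density is an average over rotations of products of binomial weights with `m + αⱼ` trials,
where the `αⱼ` are bounded. Since `p + qX = 1 + q(X - 1)`, each weight expands in differences of the
weights with `m` trials (`gapDensity_eq_sum`). The coefficient at multi-order `d` is a cyclic
average of `∏ (αⱼ choose dⱼ)`, a polynomial of degree at most `∑ dⱼ` in the gaps, so the two
expansions agree up to total order `z`. By the norms of the Krawtchouk polynomials, an `i`-th
difference has squared chi-square norm `O(m^{-i})`. The squared Hellinger distance is thus
`O(m^{-(z+1)})` (`exists_hellinger_gapDensity_le`), and a test needs at least a constant times its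
inverse in samples (`one_le_mul_hellinger`). -/

namespace CircularTrace

/-! ### Products of independent laws -/

section IndependentProducts

variable {α β : Type}

/-- The joint law of independent samples, the `j`-th one from `μ j`. -/
noncomputable def indep : (k : ℕ) → (Fin k → PMF α) → PMF (Fin k → α)
  | 0, _ => PMF.pure Fin.elim0
  | k + 1, μ => (μ 0).bind fun a => (indep k fun j => μ j.succ).map fun s => Fin.cons a s

theorem iid_eq_indep (μ : PMF α) (T : ℕ) : iid μ T = indep T fun _ => μ := by
  induction T with
  | zero => rfl
  | succ T ih => rw [iid, indep, ih]

theorem indep_apply (k : ℕ) (μ : Fin k → PMF α) (s : Fin k → α) :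
    indep k μ s = ∏ j, μ j (s j) := by
  induction k with
  | zero =>
    rw [indep, PMF.pure_apply, if_pos (Subsingleton.elim _ _)]
    simp
  | succ k ih =>
    classical
    have hmap : ∀ a, ((indep k fun j => μ j.succ).map fun s' => (Fin.cons a s' : Fin (k + 1) → α)) s
        = if s 0 = a then indep k (fun j => μ j.succ) (Fin.tail s) else 0 := by
      intro a
      rw [PMF.map_apply, tsum_eq_single (Fin.tail s)]
      · congr 1
        refine propext ⟨fun h => ?_, fun h => ?_⟩
        · rw [h, Fin.cons_zero]
        · rw [← h, Fin.cons_self_tail]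
      · intro s' hs'
        rw [if_neg]
        rintro rfl
        exact hs' (by simp)
    rw [indep, PMF.bind_apply, Fin.prod_univ_succ, tsum_eq_single (s 0)]
    · rw [hmap, if_pos rfl, ih]
      rfl
    · intro a ha
      rw [hmap, if_neg (Ne.symm ha), mul_zero]

/-- Noise acting separately on each sample may be added after all samples are drawn; this is what
allows traces to be simulated. -/
theorem indep_bind (k : ℕ) (μ : Fin k → PMF α) (K : α → PMF β) :
    (indep k fun j => (μ j).bind K) = (indep k μ).bind fun s => indep k fun j => K (s j) := by
  induction k with
  | zero => simp only [indep, PMF.pure_bind]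
  | succ k ih =>
    simp only [indep, ih, PMF.bind_bind, PMF.map_bind, PMF.bind_map, Function.comp_def,
      Fin.cons_zero, Fin.cons_succ]
    congr 1
    funext a
    rw [PMF.bind_comm]

end IndependentProducts

/-! ### The channel: rotation invariance and deletion of zeros before ones -/

section Deletion

variable (p : unitInterval)

theorem deleteBits_append (u v : List Bool) :
    deleteBits p (u ++ v) =
      (deleteBits p u).bind fun u' => (deleteBits p v).map fun v' => u' ++ v' := by
  induction u with
  | nil =>
    simp only [deleteBits, PMF.pure_bind, List.nil_append]
    exact (PMF.map_id _).symm
  | cons b u ih =>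
    simp only [List.cons_append, deleteBits, ih, PMF.bind_bind, PMF.map_bind, PMF.bind_map,
      PMF.map_comp]
    congr 1
    funext d
    congr 1
    funext u'
    cases d <;> rfl

theorem randomShift_of_length {l : List Bool} {n : ℕ} (h : l.length = n + 1) :
    randomShift l = (PMF.uniformOfFintype (Fin (n + 1))).map fun s : Fin (n + 1) => l.rotate s := by
  cases l with
  | nil => simp at h
  | cons b t =>
    obtain rfl : t.length = n := by simpa using h
    -- In `randomShift` the shift is a natural number, so the uniform law on `Fin` is coerced
    -- monadically to `ℕ`; this makes the coercion explicit.
    change ((PMF.uniformOfFintype (Fin (t.length + 1))).bind fun a => PMF.pure (a : ℕ)).map _ = _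
    rw [PMF.map_bind]
    simp only [PMF.pure_map]
    rfl

theorem uniformOfFintype_map_equiv {γ δ : Type} [Fintype γ] [Nonempty γ] (e : γ ≃ γ) (f : γ → δ) :
    (PMF.uniformOfFintype γ).map (fun s => f (e s)) = (PMF.uniformOfFintype γ).map f := by
  classical
  ext b
  simp only [PMF.map_apply, PMF.uniformOfFintype_apply]
  exact e.tsum_eq (fun a => if b = f a then ((Fintype.card γ : ENNReal))⁻¹ else 0)

/-- A prior rotation only translates the uniform shift in the cyclic group. -/
theorem randomShift_rotate (l : List Bool) (m : ℕ) :
    randomShift (l.rotate m) = randomShift l := by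
  rcases hl : l.length with _ | n
  · rw [List.length_eq_zero_iff.1 hl, List.rotate_nil]
  · rw [randomShift_of_length hl, randomShift_of_length ((List.length_rotate _ _).trans hl),
      ← uniformOfFintype_map_equiv (Equiv.addLeft (Fin.ofNat (n + 1) m))
        fun s : Fin (n + 1) => l.rotate s]
    congr 1
    funext s
    rw [List.rotate_rotate, ← List.rotate_mod l (m + s), hl]
    congr 1
    simp [Fin.val_add, Fin.ofNat]

theorem randomShift_append_comm (u v : List Bool) :
    randomShift (u ++ v) = randomShift (v ++ u) := by
  rw [← List.rotate_append_length_eq u v, randomShift_rotate]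

/-- The two blocks lose bits independently, and their survivors in either order differ by a
rotation. -/
theorem Del_append_comm (u v : List Bool) : Del p (u ++ v) = Del p (v ++ u) := by
  simp only [Del, deleteBits_append, PMF.bind_bind, PMF.bind_map, Function.comp_def]
  rw [PMF.bind_comm]
  simp only [randomShift_append_comm]

theorem gapString_succ {k : ℕ} (a : Fin (k + 1) → ℕ) :
    gapString a = (true :: List.replicate (a 0) false) ++ gapString fun j => a j.succ := by
  simp [gapString, List.ofFn_succ]

theorem gapString_rotate {k : ℕ} (a : Fin (k + 1) → ℕ) :
    gapString (fun j => a (j + 1)) =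
      (gapString fun j => a j.succ) ++ (true :: List.replicate (a 0) false) := by
  rw [gapString, List.ofFn_succ']
  simp [gapString, Fin.coeSucc_eq_succ]

theorem Del_gapString_add {k : ℕ} (a : Fin (k + 1) → ℕ) (r : Fin (k + 1)) :
    Del p (gapString fun j => a (j + r)) = Del p (gapString a) := by
  induction r using Fin.induction with
  | zero => simp
  | succ r ih =>
    have e : (fun j : Fin (k + 1) => a (j + r.succ)) = fun j => a (j + 1 + r.castSucc) := by
      funext j
      rw [← Fin.coeSucc_eq_succ, add_assoc, add_comm 1]
    rw [e, gapString_rotate fun j => a (j + r.castSucc), Del_append_comm, ← ih,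
      ← gapString_succ fun j => a (j + r.castSucc)]

/-- The number of survivors among `m` bits deleted independently. -/
noncomputable def survivors : ℕ → PMF ℕ
  | 0 => PMF.pure 0
  | m + 1 => (coin p).bind fun deleted =>
      (survivors m).map fun b => bif deleted then b else b + 1

/-- Delete each `1` of a string independently, keeping all the `0`s. -/
noncomputable def deleteOnes : List Bool → PMF (List Bool)
  | [] => PMF.pure []
  | true :: l => (coin p).bind fun deleted =>
      (deleteOnes l).map fun l' => bif deleted then l' else true :: l'
  | false :: l => (deleteOnes l).map fun l' => false :: l'

theorem deleteBits_replicate_false (m : ℕ) :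
    deleteBits p (List.replicate m false) =
      (survivors p m).map fun b => List.replicate b false := by
  induction m with
  | zero => simp [deleteBits, survivors, PMF.pure_map]
  | succ m ih =>
    simp only [List.replicate_succ, deleteBits, survivors, ih, PMF.map_bind, PMF.map_comp]
    congr 1
    funext d
    congr 1
    funext b
    cases d <;> simp [List.replicate_succ]

theorem deleteOnes_replicate_false_append (m : ℕ) (l : List Bool) :
    deleteOnes p (List.replicate m false ++ l) =
      (deleteOnes p l).map fun l' => List.replicate m false ++ l' := by
  induction m with
  | zero =>
    simp only [List.replicate_zero, List.nil_append]
    exact (PMF.map_id _).symm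
  | succ m ih =>
    simp only [List.replicate_succ, List.cons_append, deleteOnes, ih, PMF.map_comp]
    rfl

/-- With all ones still present as separators, the zeros of each gap are thinned independently of
everything else. -/
theorem deleteBits_gapString {k : ℕ} (a : Fin k → ℕ) :
    deleteBits p (gapString a) =
      (indep k fun j => survivors p (a j)).bind fun b => deleteOnes p (gapString b) := by
  induction k with
  | zero => simp [gapString, deleteBits, indep, deleteOnes]
  | succ k ih =>
    rw [gapString_succ, List.cons_append, deleteBits, deleteBits_append,
      deleteBits_replicate_false, ih]
    simp only [indep, PMF.bind_bind, PMF.map_bind, PMF.bind_map, Function.comp_def,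
      gapString_succ, List.cons_append, deleteOnes, deleteOnes_replicate_false_append, PMF.map_comp,
      Fin.cons_zero, Fin.cons_succ]
    rw [PMF.bind_comm]
    congr 1
    funext b
    rw [PMF.bind_comm]

/-- The law of the gaps between the ones, when only zeros are deleted, read off from a uniformly
random one of the ones. -/
noncomputable def gapLaw {k : ℕ} (a : Fin (k + 1) → ℕ) : PMF (Fin (k + 1) → ℕ) :=
  (PMF.uniformOfFintype (Fin (k + 1))).bind fun r => indep (k + 1) fun j => survivors p (a (j + r))

/-- The law on the left is constant in the rotation `r`, so it equals its average over `r`. What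
remains on the right after `gapLaw` is a channel that does not depend on `a`. -/
theorem Del_gapString {k : ℕ} (a : Fin (k + 1) → ℕ) :
    Del p (gapString a) =
      (gapLaw p a).bind fun b => (deleteOnes p (gapString b)).bind randomShift := by
  rw [gapLaw, PMF.bind_bind, ← PMF.bind_const (PMF.uniformOfFintype (Fin (k + 1)))
    (Del p (gapString a))]
  congr 1
  funext r
  rw [← Del_gapString_add p a r, Del, deleteBits_gapString, PMF.bind_bind]

end Deletion

/-- Data processing: the new test passes each sample through `K` and then runs `A`. -/
theorem exists_distinguishing_of_bind {α : Type} {T : ℕ} (A : Algorithm T) (μ ν : PMF α)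
    (K : α → PMF (List Bool)) (h : Distinguishes A (μ.bind K) (ν.bind K)) :
    ∃ B : (Fin T → α) → PMF Bool,
      2 / 3 ≤ ((iid μ T).bind B) true ∧ 2 / 3 ≤ ((iid ν T).bind B) false := by
  refine ⟨fun s => (indep T fun j => K (s j)).bind A, ?_⟩
  simpa only [Distinguishes, iid_eq_indep, indep_bind, PMF.bind_bind] using h

/-! ### Hypothesis testing and Hellinger distance -/

section Testing

theorem sum_toReal_eq_one {α : Type} (μ : PMF α) {S : Finset α} (h : ∀ a ∉ S, μ a = 0) :
    ∑ a ∈ S, (μ a).toReal = 1 := by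
  have hsum : ∑' a, μ a = ∑ a ∈ S, μ a := tsum_eq_sum fun a ha => h a ha
  rw [← ENNReal.toReal_sum fun a _ => μ.apply_ne_top a, ← hsum, μ.tsum_coe, ENNReal.toReal_one]

theorem bind_toReal {α β : Type} (μ : PMF α) {S : Finset α} (h : ∀ a ∉ S, μ a = 0)
    (B : α → PMF β) (c : β) :
    ((μ.bind B) c).toReal = ∑ a ∈ S, (μ a).toReal * (B a c).toReal := by
  rw [PMF.bind_apply, tsum_eq_sum fun a ha => by rw [h a ha, zero_mul],
    ENNReal.toReal_sum fun a _ => ENNReal.mul_ne_top (μ.apply_ne_top a) ((B a).apply_ne_top c)]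
  simp only [ENNReal.toReal_mul]

/-- Two laws between which a test decides with error `1/3` have affinity bounded away from `1`. -/
theorem affinity_le_of_test {ι : Type} (W : Finset ι) (f g w : ι → ℝ)
    (hf : ∀ i, 0 ≤ f i) (hg : ∀ i, 0 ≤ g i) (hw : ∀ i, 0 ≤ w i) (hw1 : ∀ i, w i ≤ 1)
    (sf : ∑ i ∈ W, f i = 1) (sg : ∑ i ∈ W, g i = 1)
    (tf : 2 / 3 ≤ ∑ i ∈ W, f i * w i) (tg : 2 / 3 ≤ ∑ i ∈ W, g i * (1 - w i)) :
    ∑ i ∈ W, √(f i * g i) ≤ 17 / 18 := by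
  -- Two weighted AM-GM bounds, valid because `4 * (1/3) * (3/4) = 1`, are mixed with weights `w`
  -- and `1 - w`; the smaller coefficient falls on the law the test favours. Summation gives `13/12
  -- - 5/18 + 5/36 = 17/18`.
  have key : ∀ i ∈ W, √(f i * g i) ≤
      3 / 4 * f i + 1 / 3 * g i - 5 / 12 * (f i * w i) + 5 / 12 * (g i - g i * (1 - w i)) := by
    intro i _
    have h1 : √(f i * g i) ≤ 1 / 3 * f i + 3 / 4 * g i := by
      refine Real.sqrt_le_iff.2 ⟨by linarith [hf i, hg i], ?_⟩
      nlinarith [sq_nonneg (1 / 3 * f i - 3 / 4 * g i)]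
    have h2 : √(f i * g i) ≤ 3 / 4 * f i + 1 / 3 * g i := by
      refine Real.sqrt_le_iff.2 ⟨by linarith [hf i, hg i], ?_⟩
      nlinarith [sq_nonneg (3 / 4 * f i - 1 / 3 * g i)]
    nlinarith [mul_le_mul_of_nonneg_left h1 (hw i),
      mul_le_mul_of_nonneg_left h2 (sub_nonneg.2 (hw1 i))]
  refine (Finset.sum_le_sum key).trans ?_
  simp only [Finset.sum_add_distrib, Finset.sum_sub_distrib, ← Finset.mul_sum, sf, sg]
  linarith

/-- The number of samples needed to decide between two laws is at least of the order of the inverse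
of their squared Hellinger distance. -/
theorem one_le_mul_hellinger {α : Type} (μ ν : PMF α) (S : Finset α) (hμ : ∀ a ∉ S, μ a = 0)
    (hν : ∀ a ∉ S, ν a = 0) {T : ℕ} (B : (Fin T → α) → PMF Bool)
    (h1 : 2 / 3 ≤ ((iid μ T).bind B) true) (h2 : 2 / 3 ≤ ((iid ν T).bind B) false) :
    1 / 9 ≤ T * ∑ a ∈ S, (√(μ a).toReal - √(ν a).toReal) ^ 2 := by
  classical
  set W := Fintype.piFinset fun _ : Fin T => S with hW
  have hsupp : ∀ ρ : PMF α, (∀ a ∉ S, ρ a = 0) → ∀ s ∉ W, iid ρ T s = 0 := by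
    intro ρ hρ s hs
    obtain ⟨j, hj⟩ : ∃ j, s j ∉ S := by simpa [hW, Fintype.mem_piFinset] using hs
    rw [iid_eq_indep, indep_apply]
    exact Finset.prod_eq_zero (Finset.mem_univ j) (hρ _ hj)
  have htwo : ∀ x : ENNReal, x ≠ ⊤ → 2 / 3 ≤ x → (2 / 3 : ℝ) ≤ x.toReal := by
    intro x hx h
    have := ENNReal.toReal_mono hx h
    simpa using this
  have hB : ∀ s, (B s false).toReal = 1 - (B s true).toReal := by
    intro s
    have := sum_toReal_eq_one (B s) (S := Finset.univ) (by simp)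
    rw [Fintype.sum_bool] at this
    linarith
  have haff := affinity_le_of_test W (fun s => (iid μ T s).toReal) (fun s => (iid ν T s).toReal)
    (fun s => (B s true).toReal) (fun _ => ENNReal.toReal_nonneg) (fun _ => ENNReal.toReal_nonneg)
    (fun _ => ENNReal.toReal_nonneg)
    (fun s => by have := hB s; have : 0 ≤ (B s false).toReal := ENNReal.toReal_nonneg; linarith)
    (sum_toReal_eq_one _ (hsupp μ hμ)) (sum_toReal_eq_one _ (hsupp ν hν))
    (by rw [← bind_toReal _ (hsupp μ hμ)]; exact htwo _ (PMF.apply_ne_top _ _) h1)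
    (by
      simp only [← hB]
      rw [← bind_toReal _ (hsupp ν hν)]
      exact htwo _ (PMF.apply_ne_top _ _) h2)
  -- Affinity is multiplicative over independent samples.
  have hprod : ∑ s ∈ W, √((iid μ T s).toReal * (iid ν T s).toReal) =
      (∑ a ∈ S, √((μ a).toReal * (ν a).toReal)) ^ T := by
    rw [Finset.sum_pow']
    refine Finset.sum_congr rfl fun s _ => ?_
    simp only [iid_eq_indep, indep_apply, ENNReal.toReal_prod, ← Finset.prod_mul_distrib]
    exact Real.sqrt_prod _ fun _ _ => by positivity
  have hH : ∑ a ∈ S, √((μ a).toReal * (ν a).toReal) =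
      1 + -(∑ a ∈ S, (√(μ a).toReal - √(ν a).toReal) ^ 2) / 2 := by
    have : ∀ a ∈ S, (√(μ a).toReal - √(ν a).toReal) ^ 2 =
        (μ a).toReal + (ν a).toReal - 2 * √((μ a).toReal * (ν a).toReal) := by
      intro a _
      rw [Real.sqrt_mul ENNReal.toReal_nonneg, sub_sq, Real.sq_sqrt ENNReal.toReal_nonneg,
        Real.sq_sqrt ENNReal.toReal_nonneg]
      ring
    rw [Finset.sum_congr rfl this, Finset.sum_sub_distrib, Finset.sum_add_distrib,
      ← Finset.mul_sum, sum_toReal_eq_one _ hμ, sum_toReal_eq_one _ hν]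
    ring
  have hnonneg : 0 ≤ ∑ a ∈ S, √((μ a).toReal * (ν a).toReal) :=
    Finset.sum_nonneg fun _ _ => Real.sqrt_nonneg _
  rw [hprod, hH] at haff
  rw [hH] at hnonneg
  -- Bernoulli's inequality: `1 - T H / 2 ≤ (1 - H / 2) ^ T ≤ 17/18`, where `H` is the squared
  -- distance.
  have := one_add_mul_le_pow (a := -(∑ a ∈ S, (√(μ a).toReal - √(ν a).toReal) ^ 2) / 2)
    (by linarith) T
  linarith

end Testing

/-! ### Binomial weights, their differences and Krawtchouk norms -/

section BinomialWeights

open Polynomial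

/-- The weight `p^(m-b) q^b (m choose b)` of `b` successes, as a coefficient of `(p + q X)^m`. -/
noncomputable def binomWeight (p q : ℝ) (m b : ℕ) : ℝ := ((C p + C q * X) ^ m).coeff b

/-- The `i`-th difference of the binomial weights, as a coefficient of `(X - 1)^i (p + q X)^m`. -/
noncomputable def binomDiff (p q : ℝ) (i m b : ℕ) : ℝ :=
  ((X - 1) ^ i * (C p + C q * X) ^ m).coeff b

theorem binomWeight_zero (p q : ℝ) (b : ℕ) : binomWeight p q 0 b = if b = 0 then 1 else 0 := by
  simp [binomWeight, coeff_one]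

theorem binomWeight_succ_zero (p q : ℝ) (m : ℕ) :
    binomWeight p q (m + 1) 0 = p * binomWeight p q m 0 := by
  simp [binomWeight, pow_succ, mul_comm p]

theorem binomWeight_succ_succ (p q : ℝ) (m b : ℕ) :
    binomWeight p q (m + 1) (b + 1) = p * binomWeight p q m (b + 1) + q * binomWeight p q m b := by
  simp only [binomWeight, pow_succ, mul_add, ← mul_assoc, coeff_add, coeff_mul_X, coeff_mul_C]
  ring

theorem binomWeight_eq (p q : ℝ) (m b : ℕ) :
    binomWeight p q m b = m.choose b * q ^ b * p ^ (m - b) := by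
  induction m generalizing b with
  | zero => cases b <;> simp [binomWeight_zero]
  | succ m ih =>
    cases b with
    | zero => rw [binomWeight_succ_zero, ih]; simp [pow_succ']
    | succ b =>
      rw [binomWeight_succ_succ, ih, ih, Nat.choose_succ_succ, Nat.add_sub_add_right]
      rcases lt_or_ge b m with h | h
      · obtain ⟨d, rfl⟩ := Nat.exists_eq_add_of_lt h
        rw [show b + d + 1 - (b + 1) = d by omega, show b + d + 1 - b = d + 1 by omega]
        push_cast
        ring
      · rw [Nat.choose_eq_zero_of_lt (show m < b + 1 by omega)]
        push_cast
        ring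

variable {p q : ℝ}

theorem binomWeight_nonneg (hp : 0 ≤ p) (hq : 0 ≤ q) (m b : ℕ) : 0 ≤ binomWeight p q m b := by
  rw [binomWeight_eq]
  positivity

theorem binomWeight_pos (hp : 0 < p) (hq : 0 < q) {m b : ℕ} (h : b ≤ m) :
    0 < binomWeight p q m b := by
  rw [binomWeight_eq]
  have : 0 < (m.choose b : ℝ) := by exact_mod_cast Nat.choose_pos h
  positivity

theorem binomWeight_eq_zero {m b : ℕ} (h : m < b) : binomWeight p q m b = 0 := by
  rw [binomWeight_eq, Nat.choose_eq_zero_of_lt h]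
  simp

theorem binomDiff_eq_zero {i m b : ℕ} (h : i + m < b) : binomDiff p q i m b = 0 := by
  refine coeff_eq_zero_of_natDegree_lt (lt_of_le_of_lt ?_ h)
  have h1 : (X - 1 : ℝ[X]).natDegree ≤ 1 := by compute_degree
  have h2 : (C p + C q * X : ℝ[X]).natDegree ≤ 1 := by compute_degree
  exact natDegree_mul_le.trans (add_le_add (natDegree_pow_le_of_le i h1 |>.trans (by simp))
    (natDegree_pow_le_of_le m h2 |>.trans (by simp)))

/-- One way to have `b` successes is that the `d` additional trials all fail. -/
theorem pow_mul_binomWeight_le (hp : 0 ≤ p) (hq : 0 ≤ q) (m d b : ℕ) :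
    p ^ d * binomWeight p q m b ≤ binomWeight p q (m + d) b := by
  induction d with
  | zero => simp
  | succ d ih =>
    have hstep : p * binomWeight p q (m + d) b ≤ binomWeight p q (m + (d + 1)) b := by
      rw [← add_assoc]
      cases b with
      | zero => rw [binomWeight_succ_zero]
      | succ b =>
        rw [binomWeight_succ_succ]
        linarith [mul_nonneg hq (binomWeight_nonneg hp hq (m + d) b)]
    calc p ^ (d + 1) * binomWeight p q m b = p * (p ^ d * binomWeight p q m b) := by ring
      _ ≤ p * binomWeight p q (m + d) b := mul_le_mul_of_nonneg_left ih hp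
      _ ≤ _ := hstep

/-- Away from the right end of the support, consecutive binomial laws are comparable. -/
theorem pow_mul_binomWeight_add_le (hp : 0 ≤ p) (hp1 : p ≤ 1) (hq : 0 ≤ q) {η : ℝ} (hη : 0 ≤ η)
    {m b : ℕ} (d : ℕ) (hη1 : η ≤ 1) (hb : (b : ℝ) ≤ (1 - η) * (m + 1)) :
    η ^ d * binomWeight p q (m + d) b ≤ binomWeight p q m b := by
  induction d with
  | zero => simp
  | succ d ih =>
    have hbm : (b : ℝ) ≤ m + 1 := by nlinarith
    have hbm' : b ≤ m + d + 1 := by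
      have : b ≤ m + 1 := by exact_mod_cast hbm
      omega
    have hw := binomWeight_nonneg hp hq (m + d) b
    have hw' := binomWeight_nonneg hp hq (m + d + 1) b
    -- The exact ratio of consecutive weights at the same `b`; at `b = m + d + 1` both sides vanish.
    have hrec : binomWeight p q (m + d + 1) b * ((m + d + 1 : ℝ) - b) =
        (m + d + 1) * (p * binomWeight p q (m + d) b) := by
      rcases Nat.lt_or_ge (m + d) b with h | h
      · obtain rfl : b = m + d + 1 := by omega
        rw [binomWeight_eq_zero (m := m + d) (by omega)]
        push_cast
        ring
      · have hc := Nat.choose_mul_succ_eq (m + d) b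
        have hc' : ((m + d).choose b : ℝ) * (m + d + 1) = (m + d + 1).choose b * (m + d + 1 - b) := by
          rw [← Nat.cast_add m d, ← Nat.cast_succ, ← Nat.cast_sub hbm']
          exact_mod_cast hc
        rw [binomWeight_eq, binomWeight_eq, Nat.sub_add_comm h, pow_succ]
        linear_combination (-(q ^ b * p ^ (m + d - b) * p)) * hc'
    have hm : (0 : ℝ) < m + d + 1 := by positivity
    have hstep : η * binomWeight p q (m + d + 1) b ≤ binomWeight p q (m + d) b := by
      have h1 : η * (m + d + 1) ≤ m + d + 1 - b := by
        nlinarith [mul_nonneg (sub_nonneg.2 hη1) (Nat.cast_nonneg (α := ℝ) d)]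
      have h2 := mul_le_mul_of_nonneg_left h1 hw'
      rw [hrec] at h2
      have h3 : (m + d + 1 : ℝ) * (η * binomWeight p q (m + d + 1) b) ≤
          (m + d + 1) * (p * binomWeight p q (m + d) b) := by linarith
      exact (le_of_mul_le_mul_left h3 hm).trans (mul_le_of_le_one_left hw hp1)
    calc η ^ (d + 1) * binomWeight p q (m + (d + 1)) b
        = η ^ d * (η * binomWeight p q (m + d + 1) b) := by rw [← add_assoc]; ring
      _ ≤ η ^ d * binomWeight p q (m + d) b := mul_le_mul_of_nonneg_left hstep (by positivity)
      _ ≤ _ := ih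

theorem sum_binomWeight (m : ℕ) (hpq : p + q = 1) :
    ∑ b ∈ Finset.range (m + 1), binomWeight p q m b = 1 := by
  have h := add_pow q p m
  rw [add_comm q p, hpq, one_pow] at h
  rw [h]
  refine Finset.sum_congr rfl fun b _ => ?_
  rw [binomWeight_eq]
  ring

/-- An exponential bound on the right tail of the binomial law. -/
theorem sum_binomWeight_tail_le (hp : 0 ≤ p) (hq : 0 ≤ q) (N u : ℕ) :
    ∑ b ∈ Finset.range (N + 1) with N ≤ b + u, binomWeight p q N b ≤ 2 ^ u * (q + p / 2) ^ N := by
  -- Chernoff: `(q + p/2)^N` counts each failure with an extra factor `1/2`, and at most `u`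
  -- failures occur in the tail.
  rw [add_pow, Finset.mul_sum]
  refine (Finset.sum_le_sum_of_subset_of_nonneg (Finset.filter_subset _ _) (fun b _ _ =>
    ?_)).trans' (Finset.sum_le_sum fun b hb => ?_)
  · positivity
  · obtain ⟨hbN, hbu⟩ := Finset.mem_filter.1 hb
    have hbu' : N - b ≤ u := by omega
    have h2 : (1 : ℝ) ≤ 2 ^ u / 2 ^ (N - b) := by
      rw [one_le_div (by positivity)]
      exact pow_le_pow_right₀ (by norm_num) hbu'
    have := mul_le_mul_of_nonneg_right h2 (binomWeight_nonneg hp hq N b)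
    rw [one_mul] at this
    refine this.trans (le_of_eq ?_)
    rw [binomWeight_eq, div_pow]
    ring

/-- Write `a` of the factors `p + qX` as `1 + q(X - 1)` and expand. Terms with `i > a` vanish, so
one range serves all `a ≤ D`. -/
theorem binomWeight_add_eq_sum (hpq : p + q = 1) (m : ℕ) {a D : ℕ} (ha : a ≤ D) (b : ℕ) :
    binomWeight p q (m + a) b =
      ∑ i ∈ Finset.range (D + 1), (a.choose i : ℝ) * q ^ i * binomDiff p q i m b := by
  have h : (C p + C q * X : ℝ[X]) = C q * (X - 1) + 1 := by
    have : (C p : ℝ[X]) = 1 - C q := by rw [← C_1, ← C_sub, ← hpq]; congr 1; ring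
    rw [this]
    ring
  have hexp : (C p + C q * X : ℝ[X]) ^ (m + a) =
      ∑ i ∈ Finset.range (a + 1), C ((a.choose i : ℝ) * q ^ i) *
        ((X - 1) ^ i * (C p + C q * X) ^ m) := by
    rw [pow_add, mul_comm]
    conv_lhs => rw [h, add_pow, ← h, Finset.sum_mul]
    refine Finset.sum_congr rfl fun i _ => ?_
    simp only [one_pow, mul_pow, C_mul, C_pow, map_natCast]
    ring
  rw [binomWeight, hexp, finsetSum_coeff]
  simp only [coeff_C_mul]
  refine Finset.sum_subset (Finset.range_subset_range.2 (by omega)) fun i _ hi => ?_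
  rw [Nat.choose_eq_zero_of_lt (by simpa using hi)]
  simp

/-- Moving the success probability by `t` adds `t(X - 1)` to `p + qX`, so the differences are Taylor
coefficients in `t`. -/
theorem sum_choose_mul_binomDiff (p q t : ℝ) (N b : ℕ) :
    ∑ i ∈ Finset.range (N + 1), ((N.choose i : ℝ) * binomDiff p q i (N - i) b) * t ^ i =
      binomWeight (p - t) (q + t) N b := by
  have h : (C (p - t) + C (q + t) * X : ℝ[X]) = C t * (X - 1) + (C p + C q * X) := by
    rw [C_sub, C_add]
    ring
  rw [binomWeight, h, add_pow, finsetSum_coeff]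
  refine Finset.sum_congr rfl fun i _ => ?_
  rw [show (C t * (X - 1)) ^ i * (C p + C q * X) ^ (N - i) * (N.choose i : ℝ[X]) =
    C ((N.choose i : ℝ) * t ^ i) * ((X - 1) ^ i * (C p + C q * X) ^ (N - i)) by
      simp only [mul_pow, C_mul, C_pow, map_natCast]; ring, coeff_C_mul, binomDiff]
  ring

theorem eq_of_sum_mul_pow_eq {n : ℕ} {u v : ℕ → ℝ}
    (h : ∀ t : ℝ, ∑ i ∈ Finset.range n, u i * t ^ i = ∑ i ∈ Finset.range n, v i * t ^ i)
    {i : ℕ} (hi : i < n) : u i = v i := by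
  have hpoly : ∑ i ∈ Finset.range n, C (u i) * X ^ i = ∑ i ∈ Finset.range n, C (v i) * X ^ i := by
    refine Polynomial.funext fun t => ?_
    simpa [eval_finsetSum] using h t
  have := congrArg (fun f : ℝ[X] => f.coeff i) hpoly
  simpa [finsetSum_coeff, coeff_X_pow, hi] using this

/-- The norms of the Krawtchouk polynomials. -/
theorem sum_binomDiff_sq_div (hp : 0 < p) (hq : 0 < q) (hpq : p + q = 1) {N i : ℕ} (hi : i ≤ N) :
    ∑ b ∈ Finset.range (N + 1), binomDiff p q i (N - i) b ^ 2 / binomWeight p q N b =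
      1 / ((p * q) ^ i * N.choose i) := by
  set g : ℕ → ℕ → ℝ := fun i b => (N.choose i : ℝ) * binomDiff p q i (N - i) b with hg
  -- The inner product of two perturbed laws depends on `s * t` only. Comparing coefficients of `t ^
  -- i`, then of `s ^ j`, gives orthogonality for `i ≠ j` and the norm for `i = j`.
  have hgen : ∀ s t : ℝ, ∑ b ∈ Finset.range (N + 1), binomWeight (p - t) (q + t) N b *
      binomWeight (p - s) (q + s) N b / binomWeight p q N b = (t * (s / (p * q)) + 1) ^ N := by
    intro s t
    have e : t * (s / (p * q)) + 1 = (q + t) * (q + s) / q + (p - t) * (p - s) / p := by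
      obtain rfl : q = 1 - p := by linarith
      field_simp
      ring
    rw [e, add_pow]
    refine Finset.sum_congr rfl fun b hb => ?_
    have hc : (N.choose b : ℝ) ≠ 0 := by
      have := Nat.choose_pos (Nat.lt_succ_iff.1 (Finset.mem_range.1 hb))
      positivity
    simp only [binomWeight_eq, div_pow, mul_pow]
    field_simp
  have h1 : ∀ s t : ℝ, ∑ i ∈ Finset.range (N + 1), (∑ b ∈ Finset.range (N + 1),
      g i b * binomWeight (p - s) (q + s) N b / binomWeight p q N b) * t ^ i =
      ∑ i ∈ Finset.range (N + 1), ((N.choose i : ℝ) * (s / (p * q)) ^ i) * t ^ i := by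
    intro s t
    have h2 := hgen s t
    rw [add_pow] at h2
    simp only [← sum_choose_mul_binomDiff p q t] at h2
    simp only [Finset.sum_mul]
    rw [Finset.sum_comm]
    simp only [Finset.sum_mul, Finset.sum_div] at h2
    refine Eq.trans ?_ (h2.trans ?_)
    · refine Finset.sum_congr rfl fun b _ => Finset.sum_congr rfl fun i _ => ?_
      simp only [hg]
      ring
    · refine Finset.sum_congr rfl fun i _ => ?_
      rw [mul_pow, one_pow]
      ring
  have h2 : ∀ s : ℝ, ∑ j ∈ Finset.range (N + 1), (∑ b ∈ Finset.range (N + 1),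
      g i b * g j b / binomWeight p q N b) * s ^ j =
      ∑ j ∈ Finset.range (N + 1), (if j = i then (N.choose i : ℝ) / (p * q) ^ i else 0) * s ^ j := by
    intro s
    have h3 := eq_of_sum_mul_pow_eq (h1 s) (Nat.lt_succ_of_le hi)
    simp only [← sum_choose_mul_binomDiff p q s] at h3
    simp only [Finset.sum_mul]
    rw [Finset.sum_comm]
    simp only [Finset.mul_sum, Finset.sum_div] at h3
    refine Eq.trans ?_ (h3.trans ?_)
    · refine Finset.sum_congr rfl fun b _ => Finset.sum_congr rfl fun j _ => ?_
      simp only [hg]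
      ring
    · simp [ite_mul, Finset.sum_ite_eq', Nat.lt_succ_of_le hi, div_pow]
      ring
  have h3 := eq_of_sum_mul_pow_eq h2 (Nat.lt_succ_of_le hi)
  have hc : (N.choose i : ℝ) ≠ 0 := by
    have := Nat.choose_pos hi
    positivity
  have h4 : ∑ b ∈ Finset.range (N + 1), g i b * g i b / binomWeight p q N b =
      (N.choose i : ℝ) ^ 2 * ∑ b ∈ Finset.range (N + 1),
        binomDiff p q i (N - i) b ^ 2 / binomWeight p q N b := by
    rw [Finset.mul_sum]
    refine Finset.sum_congr rfl fun b _ => ?_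
    simp only [hg]
    ring
  rw [h4, if_pos rfl] at h3
  refine mul_left_cancel₀ (pow_ne_zero 2 hc) (h3.trans ?_)
  field_simp

/-- The exact norm refers to `m + i` trials; passing to a reference common to all orders costs `1 /
p ^ D`. The decay comes from `m ^ i ≤ D! * (m + i choose i)`. -/
theorem sum_binomDiff_sq_div_le (hp : 0 < p) (hq : 0 < q) (hpq : p + q = 1) {m i D : ℕ}
    (hm : 0 < m) (hi : i ≤ D) :
    ∑ b ∈ Finset.range (m + D + 1), binomDiff p q i m b ^ 2 / binomWeight p q (m + D) b ≤
      D.factorial / (p * (p * q)) ^ D * (1 / m : ℝ) ^ i := by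
  have hq1 : q ≤ 1 := by linarith
  have hp1 : p ≤ 1 := by linarith
  have hterm : ∀ b ∈ Finset.range (m + D + 1),
      binomDiff p q i m b ^ 2 / binomWeight p q (m + D) b ≤
        1 / p ^ D * (binomDiff p q i m b ^ 2 / binomWeight p q (m + i) b) := by
    intro b _
    rcases Nat.lt_or_ge (m + i) b with h | h
    · rw [binomDiff_eq_zero (by omega)]
      simp
    · have hpos := binomWeight_pos hp hq h
      have hle : p ^ D * binomWeight p q (m + i) b ≤ binomWeight p q (m + D) b := by
        have := pow_mul_binomWeight_le hp.le hq.le (m + i) (D - i) b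
        rw [show m + i + (D - i) = m + D by omega] at this
        exact (mul_le_mul_of_nonneg_right (pow_le_pow_of_le_one hp.le hp1 (by omega)) hpos.le).trans
          this
      rw [div_mul_div_comm, one_mul]
      exact div_le_div_of_nonneg_left (sq_nonneg _) (by positivity) hle
  have hrange : ∑ b ∈ Finset.range (m + D + 1), binomDiff p q i m b ^ 2 / binomWeight p q (m + i) b
      = ∑ b ∈ Finset.range (m + i + 1),
        binomDiff p q i m b ^ 2 / binomWeight p q (m + i) b := by
    refine (Finset.sum_subset (Finset.range_subset_range.2 (by omega)) fun b _ hb => ?_).symm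
    rw [binomDiff_eq_zero (by simp at hb; omega)]
    simp
  have hk := sum_binomDiff_sq_div hp hq hpq (Nat.le_add_left i m)
  rw [Nat.add_sub_cancel] at hk
  have hchoose : (m : ℝ) ^ i ≤ D.factorial * (m + i).choose i := by
    have h1 := Nat.pow_sub_le_descFactorial (m + i) i
    rw [Nat.descFactorial_eq_factorial_mul_choose] at h1
    have h2 : m ^ i ≤ D.factorial * (m + i).choose i :=
      (Nat.pow_le_pow_left (by omega) i).trans
        (h1.trans (Nat.mul_le_mul_right _ (Nat.factorial_le hi)))
    exact_mod_cast h2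
  have hc : (0 : ℝ) < (m + i).choose i := by exact_mod_cast Nat.choose_pos (Nat.le_add_left i m)
  have hm' : (0 : ℝ) < m := by exact_mod_cast hm
  refine (Finset.sum_le_sum hterm).trans ?_
  rw [← Finset.mul_sum, hrange, hk]
  have h1 : 1 / ((m + i).choose i : ℝ) ≤ D.factorial * (1 / m : ℝ) ^ i := by
    rw [one_div_pow, mul_one_div, div_le_div_iff₀ hc (by positivity), one_mul]
    exact hchoose
  have h2 : 1 / (p * q) ^ i ≤ 1 / (p * q) ^ D :=
    one_div_le_one_div_of_le (by positivity)
      (pow_le_pow_of_le_one (by positivity) (mul_le_one₀ hp1 hq.le hq1) hi)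
  calc 1 / p ^ D * (1 / ((p * q) ^ i * ((m + i).choose i : ℝ)))
      = 1 / p ^ D * (1 / (p * q) ^ i * (1 / ((m + i).choose i : ℝ))) := by
        rw [div_mul_div_comm 1 ((p * q) ^ i), one_mul]
    _ ≤ 1 / p ^ D * (1 / (p * q) ^ D * (D.factorial * (1 / m : ℝ) ^ i)) := by gcongr
    _ = _ := by rw [mul_pow p (p * q)]; ring

end BinomialWeights

/-! ### Polynomial consequences of equal cyclic statistics -/

section CyclicStatistics

open Polynomial

/-- Such a sum is the cyclic statistic whose index list contains each `j` exactly `e j` times. -/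
theorem sum_prod_pow_eq {k z : ℕ} {x y : Fin k → ℤ} (h : SameCyclicStats z x y) (e : Fin k → ℕ)
    (he : ∑ j, e j ≤ z) : ∑ r, ∏ j, x (j + r) ^ e j = ∑ r, ∏ j, y (j + r) ^ e j := by
  have key : ∀ w : Fin k → ℤ, ∑ r, ∏ j, w (j + r) ^ e j =
      cyclicStat (fun t : Fin (∑ j, e j) => (finSigmaFinEquiv.symm t).1) w := by
    intro w
    refine Finset.sum_congr rfl fun r _ => ?_
    rw [finSigmaFinEquiv.symm.prod_comp fun s : (j : Fin k) × Fin (e j) => w (s.1 + r),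
      Fintype.prod_sigma]
    simp
  rw [key, key, h _ he]

theorem sum_prod_eval_eq {k z : ℕ} {x y : Fin k → ℤ} (h : SameCyclicStats z x y)
    (f : Fin k → ℝ[X]) (hf : ∑ j, (f j).natDegree ≤ z) :
    ∑ r, ∏ j, (f j).eval (x (j + r) : ℝ) = ∑ r, ∏ j, (f j).eval (y (j + r) : ℝ) := by
  have key : ∀ w : Fin k → ℤ, ∑ r, ∏ j, (f j).eval (w (j + r) : ℝ) =
      ∑ e ∈ Fintype.piFinset fun j => Finset.range ((f j).natDegree + 1),
        (∏ j, (f j).coeff (e j)) * ((∑ r, ∏ j, w (j + r) ^ e j : ℤ) : ℝ) := by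
    intro w
    simp only [eval_eq_sum_range, Finset.prod_univ_sum]
    rw [Finset.sum_comm]
    refine Finset.sum_congr rfl fun e _ => ?_
    push_cast
    rw [Finset.mul_sum]
    simp only [Finset.prod_mul_distrib]
  rw [key, key]
  refine Finset.sum_congr rfl fun e he => ?_
  rw [sum_prod_pow_eq h e (le_trans (Finset.sum_le_sum fun j _ => ?_) hf)]
  exact Nat.lt_succ_iff.1 (Finset.mem_range.1 (Fintype.mem_piFinset.1 he j))

/-- `(v + M choose d)` is a polynomial in `v` of degree `d`, a falling factorial over `d!`; the
bound `|v| ≤ M` keeps `toNat` from truncating. -/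
theorem sum_prod_choose_eq {k z M : ℕ} {x y : Fin k → ℤ} (h : SameCyclicStats z x y)
    (hx : ∀ j, |x j| ≤ M) (hy : ∀ j, |y j| ≤ M) (d : Fin k → ℕ) (hd : ∑ j, d j ≤ z) :
    ∑ r, ∏ j, (((x (j + r) + M).toNat.choose (d j) : ℕ) : ℝ) =
      ∑ r, ∏ j, (((y (j + r) + M).toNat.choose (d j) : ℕ) : ℝ) := by
  set f : Fin k → ℝ[X] := fun j =>
    C (1 / ((d j).factorial : ℝ)) * (descPochhammer ℝ (d j)).comp (X + C (M : ℝ)) with hf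
  have heval : ∀ v : ℤ, |v| ≤ M → ∀ j,
      (((v + M).toNat.choose (d j) : ℕ) : ℝ) = (f j).eval (v : ℝ) := by
    intro v hv j
    have hv' : (v : ℝ) + M = ((v + M).toNat : ℝ) := by
      have h1 : ((v + M).toNat : ℤ) = v + M := Int.toNat_of_nonneg (by linarith [neg_le_of_abs_le hv])
      have h2 : (((v + M).toNat : ℤ) : ℝ) = ((v + M : ℤ) : ℝ) := by rw [h1]
      push_cast at h2
      exact h2.symm
    have hfac : ((d j).factorial : ℝ) ≠ 0 := by positivity
    simp only [hf, eval_mul, eval_C, eval_comp, eval_add, eval_X, hv',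
      descPochhammer_eval_eq_descFactorial, Nat.descFactorial_eq_factorial_mul_choose]
    push_cast
    field_simp
  have hdeg : ∀ j, (f j).natDegree ≤ d j := by
    intro j
    refine (natDegree_C_mul_le _ _).trans (natDegree_comp_le.trans ?_)
    rw [descPochhammer_natDegree, natDegree_X_add_C, mul_one]
  simp only [fun r j => heval _ (hx (j + r)) j, fun r j => heval _ (hy (j + r)) j]
  exact sum_prod_eval_eq h f ((Finset.sum_le_sum fun j _ => hdeg j).trans hd)

end CyclicStatistics

/-! ### Pointwise Hellinger bounds and exponential tails -/

section Hellinger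

variable {p q : ℝ}

theorem sq_sqrt_sub_sqrt_le_add {u v : ℝ} (hu : 0 ≤ u) (hv : 0 ≤ v) :
    (√u - √v) ^ 2 ≤ u + v := by
  nlinarith [Real.sq_sqrt hu, Real.sq_sqrt hv, mul_nonneg (Real.sqrt_nonneg u) (Real.sqrt_nonneg v)]

theorem sq_sqrt_sub_sqrt_le_div {u v : ℝ} (hu : 0 ≤ u) (hv : 0 < v) :
    (√u - √v) ^ 2 ≤ (u - v) ^ 2 / v := by
  rw [le_div_iff₀ hv]
  have h : u - v = (√u - √v) * (√u + √v) := by nlinarith [Real.sq_sqrt hu, Real.sq_sqrt hv.le]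
  rw [h, mul_pow]
  refine mul_le_mul_of_nonneg_left ?_ (sq_nonneg _)
  nlinarith [Real.sq_sqrt hu, Real.sq_sqrt hv.le,
    mul_nonneg (Real.sqrt_nonneg u) (Real.sqrt_nonneg v)]

/-- In the Chernoff bound `2 ^ u (q + p/2) ^ m`, with `u` about `η m`, one square root of the second
factor absorbs `2 ^ u` for small `η`; the other is the rate `ρ`. -/
theorem exists_binomWeight_tail_le (hp : 0 < p) (hq : 0 < q) (hpq : p + q = 1) (D : ℕ) :
    ∃ η : ℝ, 0 < η ∧ η ≤ 1 ∧ ∃ ρ : ℝ, 0 < ρ ∧ ρ < 1 ∧ ∃ C : ℝ, 0 < C ∧ ∀ m : ℕ,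
      ∑ b ∈ Finset.range (m + D + 1) with (1 - η) * ((m : ℝ) + 1) < (b : ℕ),
        binomWeight p q (m + D) b ≤ C * ρ ^ m := by
  set ρ := √(q + p / 2) with hρ
  have hr0 : 0 < q + p / 2 := by positivity
  have hρ0 : 0 < ρ := Real.sqrt_pos.2 hr0
  have hρ1 : ρ < 1 := by
    rw [hρ, Real.sqrt_lt' one_pos]
    linarith
  have hρsq : q + p / 2 = ρ * ρ := (Real.mul_self_sqrt hr0.le).symm
  -- With `η = 1 / (e + 1)`, each factor `2` is paid for by `e + 1` factors `ρ`. Rounding `u` up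
  -- costs the `ρ ^ (e + 2)` in the constant.
  obtain ⟨e, he⟩ := exists_pow_lt_of_lt_one (show (0 : ℝ) < 1 / 2 by norm_num) hρ1
  have hρe : 2 * ρ ^ (e + 1) ≤ 1 := by
    have : ρ ^ (e + 1) ≤ ρ ^ e := pow_le_pow_of_le_one hρ0.le hρ1.le (Nat.le_succ e)
    linarith
  have he0 : (0 : ℝ) < (e : ℝ) + 1 := by positivity
  refine ⟨1 / (e + 1), by positivity, ?_, ρ, hρ0, hρ1, 2 ^ D / ρ ^ (e + 2), by positivity,
    fun m => ?_⟩
  · rw [div_le_one he0]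
    linarith [Nat.cast_nonneg (α := ℝ) e]
  set u := ⌈((m : ℝ) + 1) / (e + 1)⌉₊ with hu
  have hu1 : ((m : ℝ) + 1) / (e + 1) ≤ u := Nat.le_ceil _
  have hu2 : (u : ℝ) < ((m : ℝ) + 1) / (e + 1) + 1 := Nat.ceil_lt_add_one (by positivity)
  have hu3 : (e + 1) * u ≤ m + (e + 2) := by
    have h1 := mul_lt_mul_of_pos_left hu2 he0
    rw [mul_add, mul_div_cancel₀ _ he0.ne'] at h1
    have h2 : (((e + 1) * u : ℕ) : ℝ) < ((m + (e + 2) : ℕ) : ℝ) := by push_cast; linarith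
    exact_mod_cast h2.le
  have hsub : (Finset.range (m + D + 1)).filter
        (fun b : ℕ => (1 - 1 / ((e : ℝ) + 1)) * ((m : ℝ) + 1) < (b : ℕ)) ⊆
      (Finset.range (m + D + 1)).filter fun b => m + D ≤ b + (u + D) := by
    intro b hb
    obtain ⟨hb1, hb2⟩ := Finset.mem_filter.1 hb
    refine Finset.mem_filter.2 ⟨hb1, ?_⟩
    have : (m : ℝ) ≤ b + u := by
      have : (1 - 1 / ((e : ℝ) + 1)) * ((m : ℝ) + 1) = m + 1 - (m + 1) / (e + 1) := by ring
      linarith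
    have : m ≤ b + u := by exact_mod_cast this
    omega
  refine (Finset.sum_le_sum_of_subset_of_nonneg hsub fun b _ _ =>
    binomWeight_nonneg hp.le hq.le _ _).trans ((sum_binomWeight_tail_le hp.le hq.le _ _).trans ?_)
  have h1 : 2 ^ u * ρ ^ (m + (e + 2)) ≤ 1 := by
    calc 2 ^ u * ρ ^ (m + (e + 2)) ≤ 2 ^ u * ρ ^ ((e + 1) * u) :=
          mul_le_mul_of_nonneg_left (pow_le_pow_of_le_one hρ0.le hρ1.le hu3) (by positivity)
      _ = (2 * ρ ^ (e + 1)) ^ u := by rw [mul_pow, pow_mul]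
      _ ≤ 1 := pow_le_one₀ (by positivity) hρe
  have h2 : ρ ^ D * ρ ^ D ≤ 1 :=
    mul_le_one₀ (pow_le_one₀ hρ0.le hρ1.le) (by positivity) (pow_le_one₀ hρ0.le hρ1.le)
  rw [hρsq, div_mul_eq_mul_div, le_div_iff₀ (by positivity)]
  calc 2 ^ (u + D) * (ρ * ρ) ^ (m + D) * ρ ^ (e + 2)
      = 2 ^ D * ρ ^ m * (2 ^ u * ρ ^ (m + (e + 2))) * (ρ ^ D * ρ ^ D) := by
        rw [mul_pow]; simp only [pow_add]; ring
    _ ≤ 2 ^ D * ρ ^ m * 1 * 1 := by gcongr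
    _ = 2 ^ D * ρ ^ m := by ring

theorem exists_pow_le_mul_inv_pow {ρ : ℝ} (h0 : 0 < ρ) (h1 : ρ < 1) (s : ℕ) :
    ∃ C : ℝ, 0 < C ∧ ∀ m : ℕ, 0 < m → ρ ^ m ≤ C * (1 / m : ℝ) ^ s := by
  obtain ⟨C, hC⟩ := (tendsto_pow_const_mul_const_pow_of_abs_lt_one s
    (show |ρ| < 1 by rwa [abs_of_pos h0])).bddAbove_range
  have hC' : ∀ m : ℕ, (m : ℝ) ^ s * ρ ^ m ≤ C := fun m => hC ⟨m, rfl⟩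
  refine ⟨C, lt_of_lt_of_le (by simpa using h0) (hC' 1), fun m hm => ?_⟩
  have : (0 : ℝ) < m := by exact_mod_cast hm
  rw [one_div_pow, mul_one_div, le_div_iff₀ (by positivity), mul_comm]
  exact hC' m

end Hellinger

/-! ### Gap densities and their Hellinger distance -/

section Density

variable {p q : ℝ} {k : ℕ}

/-- The density of the cyclically shifted gaps between the ones after deletion of zeros. -/
noncomputable def gapDensity (p q : ℝ) (a b : Fin (k + 1) → ℕ) : ℝ :=
  (∑ r, ∏ j, binomWeight p q (a (j + r)) (b j)) / (k + 1)

theorem le_gapDensity {a b : Fin (k + 1) → ℕ} {v : ℝ}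
    (h : ∀ r, v ≤ ∏ j, binomWeight p q (a (j + r)) (b j)) : v ≤ gapDensity p q a b := by
  rw [gapDensity, le_div_iff₀ (by positivity)]
  have := Finset.card_nsmul_le_sum Finset.univ _ v fun r _ => h r
  simp only [Finset.card_univ, Fintype.card_fin, nsmul_eq_mul] at this
  push_cast at this
  linarith

theorem gapDensity_le {a b : Fin (k + 1) → ℕ} {v : ℝ}
    (h : ∀ r, ∏ j, binomWeight p q (a (j + r)) (b j) ≤ v) : gapDensity p q a b ≤ v := by
  rw [gapDensity, div_le_iff₀ (by positivity)]
  have := Finset.sum_le_card_nsmul Finset.univ _ v fun r _ => h r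
  simp only [Finset.card_univ, Fintype.card_fin, nsmul_eq_mul] at this
  push_cast at this
  linarith

theorem gapDensity_nonneg (hp : 0 ≤ p) (hq : 0 ≤ q) (a b : Fin (k + 1) → ℕ) :
    0 ≤ gapDensity p q a b :=
  le_gapDensity fun _ => Finset.prod_nonneg fun _ _ => binomWeight_nonneg hp hq _ _

/-- All rotations and offsets are compared with one reference product law. The lower comparison
needs `b` away from the right end, where the reference has mass that a smaller number of trials
cannot reach. -/
theorem mul_prod_binomWeight_le_gapDensity (hp : 0 ≤ p) (hp1 : p ≤ 1) (hq : 0 ≤ q) {η : ℝ}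
    (hη : 0 ≤ η) (hη1 : η ≤ 1) {m D : ℕ} {α b : Fin (k + 1) → ℕ} (hα : ∀ j, α j ≤ D)
    (hb : ∀ j, (b j : ℝ) ≤ (1 - η) * (m + 1)) :
    (η ^ D) ^ (k + 1) * ∏ j, binomWeight p q (m + D) (b j) ≤
      gapDensity p q (fun j => m + α j) b := by
  refine le_gapDensity fun r => ?_
  have hpow : (η ^ D) ^ (k + 1) = ∏ _j : Fin (k + 1), η ^ D := by simp
  rw [hpow, ← Finset.prod_mul_distrib]
  refine Finset.prod_le_prod
    (fun j _ => mul_nonneg (by positivity) (binomWeight_nonneg hp hq _ _)) fun j _ => ?_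
  have h := pow_mul_binomWeight_add_le (p := p) hp hp1 hq hη (m := m + α (j + r)) (b := b j)
    (D - α (j + r)) hη1 ((hb j).trans (by
      push_cast
      nlinarith [mul_nonneg (sub_nonneg.2 hη1) (Nat.cast_nonneg (α := ℝ) (α (j + r)))]))
  rw [show m + α (j + r) + (D - α (j + r)) = m + D by have := hα (j + r); omega] at h
  exact (mul_le_mul_of_nonneg_right (pow_le_pow_of_le_one hη hη1 (Nat.sub_le _ _))
    (binomWeight_nonneg hp hq _ _)).trans h

theorem gapDensity_le_mul_prod_binomWeight (hp : 0 < p) (hp1 : p ≤ 1) (hq : 0 ≤ q) {m D : ℕ}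
    {α b : Fin (k + 1) → ℕ} (hα : ∀ j, α j ≤ D) :
    gapDensity p q (fun j => m + α j) b ≤
      (1 / p ^ D) ^ (k + 1) * ∏ j, binomWeight p q (m + D) (b j) := by
  refine gapDensity_le fun r => ?_
  have hpow : (1 / p ^ D) ^ (k + 1) = ∏ _j : Fin (k + 1), 1 / p ^ D := by simp
  rw [hpow, ← Finset.prod_mul_distrib]
  refine Finset.prod_le_prod (fun j _ => binomWeight_nonneg hp.le hq _ _) fun j _ => ?_
  have h := pow_mul_binomWeight_le hp.le hq (m + α (j + r)) (D - α (j + r)) (b j)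
  rw [show m + α (j + r) + (D - α (j + r)) = m + D by have := hα (j + r); omega] at h
  rw [one_div_mul_eq_div, le_div_iff₀ (by positivity), mul_comm]
  exact (mul_le_mul_of_nonneg_right (pow_le_pow_of_le_one hp.le hp1 (Nat.sub_le _ _))
    (binomWeight_nonneg hp.le hq _ _)).trans h

/-- The mass of the box outside the region where all coordinates satisfy `good`. -/
theorem sum_prod_binomWeight_bad_le (hp : 0 ≤ p) (hq : 0 ≤ q) (hpq : p + q = 1) (N : ℕ)
    (good : ℕ → Prop) [DecidablePred good] :
    ∑ b ∈ Fintype.piFinset fun _ : Fin (k + 1) => Finset.range (N + 1),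
        (if ∀ j, good (b j) then 0 else ∏ j, binomWeight p q N (b j)) ≤
      (k + 1) * ∑ v ∈ Finset.range (N + 1) with ¬ good v, binomWeight p q N v := by
  -- Union bound over the failing coordinate `i`: `g i` restricts that coordinate to bad values and
  -- leaves the others free, each contributing total mass `1`.
  set g : Fin (k + 1) → Fin (k + 1) → ℕ → ℝ := fun i j v =>
    if j = i ∧ good v then 0 else binomWeight p q N v with hg
  have hg0 : ∀ i j v, 0 ≤ g i j v := by
    intro i j v
    simp only [hg]
    split_ifs
    exacts [le_rfl, binomWeight_nonneg hp hq _ _]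
  have hpt : ∀ b : Fin (k + 1) → ℕ, (if ∀ j, good (b j) then 0 else ∏ j, binomWeight p q N (b j)) ≤
      ∑ i, ∏ j, g i j (b j) := by
    intro b
    split_ifs with h
    · exact Finset.sum_nonneg fun i _ => Finset.prod_nonneg fun j _ => hg0 _ _ _
    · push Not at h
      obtain ⟨i, hi⟩ := h
      refine le_trans (le_of_eq ?_) (Finset.single_le_sum (f := fun i => ∏ j, g i j (b j))
        (fun i _ => Finset.prod_nonneg fun j _ => hg0 _ _ _) (Finset.mem_univ i))
      refine Finset.prod_congr rfl fun j _ => ?_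
      simp only [hg]
      rw [if_neg]
      rintro ⟨rfl, h⟩
      exact hi h
  refine (Finset.sum_le_sum fun b _ => hpt b).trans ?_
  rw [Finset.sum_comm]
  have hval : ∀ i : Fin (k + 1),
      ∑ b ∈ Fintype.piFinset fun _ : Fin (k + 1) => Finset.range (N + 1), ∏ j, g i j (b j) =
        ∑ v ∈ Finset.range (N + 1) with ¬ good v, binomWeight p q N v := by
    intro i
    rw [← Finset.prod_univ_sum, Fintype.prod_eq_single i]
    · rw [Finset.sum_filter]
      refine Finset.sum_congr rfl fun v _ => ?_
      simp only [hg, true_and]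
      split_ifs <;> simp_all
    · intro j hj
      simp only [hg, hj, false_and, if_false]
      exact sum_binomWeight N hpq
  simp [hval]

/-- The expansion of the density in products of differences of binomial weights. -/
theorem gapDensity_eq_sum (hpq : p + q = 1) {m D : ℕ} {α : Fin (k + 1) → ℕ} (hα : ∀ j, α j ≤ D)
    (b : Fin (k + 1) → ℕ) :
    gapDensity p q (fun j => m + α j) b =
      ∑ d ∈ Fintype.piFinset fun _ : Fin (k + 1) => Finset.range (D + 1),
        ((∑ r, ∏ j, ((α (j + r)).choose (d j) : ℝ)) / (k + 1) * ∏ j, q ^ d j) *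
          ∏ j, binomDiff p q (d j) m (b j) := by
  rw [gapDensity]
  simp only [fun r j => binomWeight_add_eq_sum hpq m (hα (j + r)) (b j), Finset.prod_univ_sum]
  rw [Finset.sum_comm, Finset.sum_div]
  refine Finset.sum_congr rfl fun d _ => ?_
  simp only [Finset.prod_mul_distrib, ← Finset.sum_mul]
  ring

theorem sum_prod_choose_mem_Icc {D : ℕ} {α : Fin (k + 1) → ℕ} (hα : ∀ j, α j ≤ D)
    (d : Fin (k + 1) → ℕ) :
    (∑ r, ∏ j, ((α (j + r)).choose (d j) : ℝ)) / (k + 1) ∈ Set.Icc (0 : ℝ) ((2 ^ D) ^ (k + 1)) := by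
  refine ⟨by positivity, ?_⟩
  rw [div_le_iff₀ (by positivity)]
  have h : ∀ r, ∏ j, ((α (j + r)).choose (d j) : ℝ) ≤ (2 ^ D) ^ (k + 1) := by
    intro r
    have hpow : ((2 : ℝ) ^ D) ^ (k + 1) = ∏ _j : Fin (k + 1), (2 : ℝ) ^ D := by simp
    rw [hpow]
    refine Finset.prod_le_prod (fun j _ => by positivity) fun j _ => ?_
    have h1 : (α (j + r)).choose (d j) ≤ 2 ^ D :=
      (Nat.choose_le_two_pow _ _).trans (Nat.pow_le_pow_right (by norm_num) (hα _))
    exact_mod_cast h1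
  have := Finset.sum_le_card_nsmul Finset.univ _ _ fun r _ => h r
  simp only [Finset.card_univ, Fintype.card_fin, nsmul_eq_mul] at this
  push_cast at this
  linarith

/-- The chi-square-type distance of two gap densities whose first `z` moments agree. -/
theorem exists_sum_sq_gapDensity_sub_le (hp : 0 < p) (hq : 0 < q) (hpq : p + q = 1) (k D z : ℕ) :
    ∃ C : ℝ, 0 < C ∧ ∀ m : ℕ, 0 < m → ∀ α β : Fin (k + 1) → ℕ, (∀ j, α j ≤ D) → (∀ j, β j ≤ D) →
      (∀ d : Fin (k + 1) → ℕ, ∑ j, d j ≤ z →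
        ∑ r, ∏ j, ((α (j + r)).choose (d j) : ℝ) = ∑ r, ∏ j, ((β (j + r)).choose (d j) : ℝ)) →
      ∑ b ∈ Fintype.piFinset fun _ : Fin (k + 1) => Finset.range (m + D + 1),
        (gapDensity p q (fun j => m + α j) b - gapDensity p q (fun j => m + β j) b) ^ 2 /
          ∏ j, binomWeight p q (m + D) (b j) ≤ C * (1 / m : ℝ) ^ (z + 1) := by
  set E := Fintype.piFinset fun _ : Fin (k + 1) => Finset.range (D + 1) with hE
  set L : ℝ := (2 ^ D) ^ (k + 1) with hL
  set C₁ : ℝ := D.factorial / (p * (p * q)) ^ D with hC₁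
  have hEne : 0 < E.card := by
    rw [hE, Fintype.card_piFinset]
    simp
  -- One `E.card` comes from Cauchy-Schwarz, the other from summing over `d`; `L` bounds the
  -- coefficients and `C₁` the norm in each coordinate.
  refine ⟨E.card * (E.card * (L ^ 2 * C₁ ^ (k + 1))), by positivity,
    fun m hm α β hα hβ hsame => ?_⟩
  have hm' : (0 : ℝ) < m := by exact_mod_cast hm
  have hm1 : (1 / m : ℝ) ≤ 1 := by
    rw [div_le_one hm']
    exact_mod_cast hm
  set c : (Fin (k + 1) → ℕ) → ℝ := fun d =>
    ((∑ r, ∏ j, ((α (j + r)).choose (d j) : ℝ)) / (k + 1) -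
      (∑ r, ∏ j, ((β (j + r)).choose (d j) : ℝ)) / (k + 1)) * ∏ j, q ^ d j with hc
  have hcL : ∀ d, c d ^ 2 ≤ L ^ 2 := by
    intro d
    obtain ⟨h1, h2⟩ := sum_prod_choose_mem_Icc hα d
    obtain ⟨h3, h4⟩ := sum_prod_choose_mem_Icc hβ d
    have hq1 : ∏ j, q ^ d j ≤ 1 := Finset.prod_le_one (fun j _ => by positivity) fun j _ =>
      pow_le_one₀ hq.le (by linarith)
    have hq0 : 0 ≤ ∏ j, q ^ d j := by positivity
    refine sq_le_sq' ?_ ?_ <;> simp only [hc] <;> nlinarith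
  have hc0 : ∀ d, ∑ j, d j ≤ z → c d = 0 := by
    intro d hd
    simp [hc, hsame d hd]
  have hw : ∀ b : Fin (k + 1) → ℕ, 0 ≤ ∏ j, binomWeight p q (m + D) (b j) := fun b =>
    Finset.prod_nonneg fun j _ => binomWeight_nonneg hp.le hq.le _ _
  have hpt : ∀ b : Fin (k + 1) → ℕ,
      (gapDensity p q (fun j => m + α j) b - gapDensity p q (fun j => m + β j) b) ^ 2 /
          ∏ j, binomWeight p q (m + D) (b j) ≤
        E.card * ∑ d ∈ E, c d ^ 2 *
          ∏ j, (binomDiff p q (d j) m (b j) ^ 2 / binomWeight p q (m + D) (b j)) := by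
    intro b
    have hdiff : gapDensity p q (fun j => m + α j) b - gapDensity p q (fun j => m + β j) b =
        ∑ d ∈ E, c d * ∏ j, binomDiff p q (d j) m (b j) := by
      rw [gapDensity_eq_sum hpq hα, gapDensity_eq_sum hpq hβ, ← Finset.sum_sub_distrib]
      refine Finset.sum_congr rfl fun d _ => ?_
      simp only [hc]
      ring
    rw [hdiff]
    refine (div_le_div_of_nonneg_right (sq_sum_le_card_mul_sum_sq) (hw b)).trans (le_of_eq ?_)
    rw [mul_div_assoc, Finset.sum_div]
    congr 1
    refine Finset.sum_congr rfl fun d _ => ?_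
    rw [mul_pow, Finset.prod_div_distrib, Finset.prod_pow, mul_div_assoc]
  refine (Finset.sum_le_sum fun b _ => hpt b).trans ?_
  rw [← Finset.mul_sum, Finset.sum_comm, mul_assoc, mul_assoc]
  refine mul_le_mul_of_nonneg_left ?_ (Nat.cast_nonneg _)
  rw [← nsmul_eq_mul]
  refine Finset.sum_le_card_nsmul _ _ _ fun d hd => ?_
  rw [← Finset.mul_sum, ← Finset.prod_univ_sum (fun _ => Finset.range (m + D + 1))
    fun j v => binomDiff p q (d j) m v ^ 2 / binomWeight p q (m + D) v]
  -- Orders above `z` have small norm; orders up to `z` have zero coefficient.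
  rcases Nat.lt_or_ge z (∑ j, d j) with hz | hz
  · have hprod : ∏ j, ∑ v ∈ Finset.range (m + D + 1),
        binomDiff p q (d j) m v ^ 2 / binomWeight p q (m + D) v ≤
        C₁ ^ (k + 1) * (1 / m : ℝ) ^ ∑ j, d j := by
      have hpow : C₁ ^ (k + 1) = ∏ _j : Fin (k + 1), C₁ := by simp
      rw [hpow, ← Finset.prod_pow_eq_pow_sum, ← Finset.prod_mul_distrib]
      refine Finset.prod_le_prod (fun j _ => Finset.sum_nonneg fun v _ =>
        div_nonneg (sq_nonneg _) (binomWeight_nonneg hp.le hq.le _ _)) fun j _ => ?_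
      exact sum_binomDiff_sq_div_le hp hq hpq hm
        (Nat.lt_succ_iff.1 (Finset.mem_range.1 (Fintype.mem_piFinset.1 hd j)))
    have hpow : (1 / m : ℝ) ^ ∑ j, d j ≤ (1 / m : ℝ) ^ (z + 1) :=
      pow_le_pow_of_le_one (by positivity) hm1 hz
    calc _ ≤ c d ^ 2 * (C₁ ^ (k + 1) * (1 / m : ℝ) ^ ∑ j, d j) :=
          mul_le_mul_of_nonneg_left hprod (sq_nonneg _)
      _ ≤ L ^ 2 * (C₁ ^ (k + 1) * (1 / m : ℝ) ^ (z + 1)) := by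
          exact mul_le_mul (hcL d) (mul_le_mul_of_nonneg_left hpow (by positivity))
            (by positivity) (by positivity)
      _ = _ := by ring
  · rw [hc0 d hz]
    simp only [ne_eq, OfNat.ofNat_ne_zero, not_false_eq_true, zero_pow, zero_mul]
    positivity

/-- Where every `b j` is away from the right end, the density dominates `e * Q` and the chi-square
estimate applies. Elsewhere the summand is at most `2 * F * Q`, of exponentially small total mass.
-/
theorem exists_hellinger_gapDensity_le (hp : 0 < p) (hq : 0 < q) (hpq : p + q = 1) (k D z : ℕ) :
    ∃ C : ℝ, 0 < C ∧ ∀ m : ℕ, 0 < m → ∀ α β : Fin (k + 1) → ℕ, (∀ j, α j ≤ D) → (∀ j, β j ≤ D) →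
      (∀ d : Fin (k + 1) → ℕ, ∑ j, d j ≤ z →
        ∑ r, ∏ j, ((α (j + r)).choose (d j) : ℝ) = ∑ r, ∏ j, ((β (j + r)).choose (d j) : ℝ)) →
      ∑ b ∈ Fintype.piFinset fun _ : Fin (k + 1) => Finset.range (m + D + 1),
        (√(gapDensity p q (fun j => m + α j) b) - √(gapDensity p q (fun j => m + β j) b)) ^ 2 ≤
          C * (1 / m : ℝ) ^ (z + 1) := by
  classical
  have hp1 : p ≤ 1 := by linarith
  obtain ⟨C₁, hC₁, h₁⟩ := exists_sum_sq_gapDensity_sub_le hp hq hpq k D z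
  obtain ⟨η, hη, hη1, ρ, hρ, hρ1, C₂, hC₂, h₂⟩ := exists_binomWeight_tail_le hp hq hpq D
  obtain ⟨C₃, hC₃, h₃⟩ := exists_pow_le_mul_inv_pow hρ hρ1 (z + 1)
  set e : ℝ := (η ^ D) ^ (k + 1) with he
  set F : ℝ := (1 / p ^ D) ^ (k + 1) with hF
  have he0 : 0 < e := by positivity
  refine ⟨1 / e * C₁ + 2 * F * ((k + 1) * (C₂ * C₃)), by positivity,
    fun m hm α β hα hβ hsame => ?_⟩
  set Q : (Fin (k + 1) → ℕ) → ℝ := fun b => ∏ j, binomWeight p q (m + D) (b j) with hQ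
  set u := gapDensity p q fun j => m + α j with hu
  set v := gapDensity p q fun j => m + β j with hv
  have hu0 : ∀ b, 0 ≤ u b := gapDensity_nonneg hp.le hq.le _
  have hv0 : ∀ b, 0 ≤ v b := gapDensity_nonneg hp.le hq.le _
  have hQ0 : ∀ b, 0 ≤ Q b := fun b => Finset.prod_nonneg fun j _ =>
    binomWeight_nonneg hp.le hq.le _ _
  have hpt : ∀ b ∈ Fintype.piFinset fun _ : Fin (k + 1) => Finset.range (m + D + 1),
      (√(u b) - √(v b)) ^ 2 ≤ 1 / e * ((u b - v b) ^ 2 / Q b) +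
        2 * F * (if ∀ j, (b j : ℝ) ≤ (1 - η) * (m + 1) then 0 else Q b) := by
    intro b hb
    split_ifs with h
    · have hQpos : 0 < Q b := Finset.prod_pos fun j _ => binomWeight_pos hp hq
        (Nat.lt_succ_iff.1 (Finset.mem_range.1 (Fintype.mem_piFinset.1 hb j)))
      have hle : e * Q b ≤ v b :=
        mul_prod_binomWeight_le_gapDensity hp.le hp1 hq.le hη.le hη1 hβ h
      have hpos : 0 < e * Q b := by positivity
      rw [mul_zero, add_zero, div_mul_div_comm, one_mul]
      exact (sq_sqrt_sub_sqrt_le_div (hu0 b) (hpos.trans_le hle)).trans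
        (div_le_div_of_nonneg_left (sq_nonneg _) hpos hle)
    · have h1 : u b ≤ F * Q b := gapDensity_le_mul_prod_binomWeight hp hp1 hq.le hα
      have h2 : v b ≤ F * Q b := gapDensity_le_mul_prod_binomWeight hp hp1 hq.le hβ
      have h3 : 0 ≤ 1 / e * ((u b - v b) ^ 2 / Q b) :=
        mul_nonneg (by positivity) (div_nonneg (sq_nonneg _) (hQ0 b))
      linarith [sq_sqrt_sub_sqrt_le_add (hu0 b) (hv0 b)]
  have hbad := sum_prod_binomWeight_bad_le (k := k) hp.le hq.le hpq (m + D)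
    fun w => (w : ℝ) ≤ (1 - η) * (m + 1)
  simp only [not_le] at hbad
  have htail : ((k : ℝ) + 1) * ∑ w ∈ Finset.range (m + D + 1) with
      (1 - η) * ((m : ℝ) + 1) < (w : ℕ), binomWeight p q (m + D) w ≤
      (k + 1) * (C₂ * (C₃ * (1 / m : ℝ) ^ (z + 1))) :=
    mul_le_mul_of_nonneg_left ((h₂ m).trans (mul_le_mul_of_nonneg_left (h₃ m hm) hC₂.le))
      (by positivity)
  refine (Finset.sum_le_sum hpt).trans ?_
  rw [Finset.sum_add_distrib, ← Finset.mul_sum, ← Finset.mul_sum]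
  refine (add_le_add (mul_le_mul_of_nonneg_left (h₁ m hm α β hα hβ hsame) (by positivity))
    (mul_le_mul_of_nonneg_left (hbad.trans htail) (by positivity))).trans (le_of_eq ?_)
  ring

end Density

/-! ### Identification of the gap law with its density -/

section Law

variable (p : unitInterval)

theorem coin_toReal_true : (coin p true).toReal = p := by
  simp [coin, PMF.ofFintype_apply, ENNReal.toReal_ofReal p.2.1]

theorem coin_toReal_false : (coin p false).toReal = 1 - p := by
  simp [coin, PMF.ofFintype_apply, ENNReal.toReal_ofReal (sub_nonneg.2 p.2.2)]

theorem map_succ_apply (μ : PMF ℕ) (b : ℕ) :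
    (μ.map fun b => b + 1) b = if b = 0 then 0 else μ (b - 1) := by
  classical
  rw [PMF.map_apply]
  cases b with
  | zero => simp
  | succ b =>
    rw [tsum_eq_single b]
    · simp
    · intro b' hb'
      rw [if_neg (by omega)]

theorem survivors_toReal (m b : ℕ) : (survivors p m b).toReal = binomWeight p (1 - p) m b := by
  induction m generalizing b with
  | zero =>
    rw [binomWeight_zero, survivors, PMF.pure_apply]
    split_ifs <;> simp
  | succ m ih =>
    have hmap : ((survivors p m).map fun b => b) = survivors p m := PMF.map_id _
    rw [survivors, bind_toReal _ (S := Finset.univ) (by simp), Fintype.sum_bool, coin_toReal_true,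
      coin_toReal_false]
    simp only [cond_true, cond_false, hmap, map_succ_apply, ih]
    cases b with
    | zero => simp [binomWeight_succ_zero]
    | succ b => simp [binomWeight_succ_succ, ih]

theorem gapLaw_toReal {k : ℕ} (a b : Fin (k + 1) → ℕ) :
    (gapLaw p a b).toReal = gapDensity (p : ℝ) (1 - p) a b := by
  rw [gapLaw, bind_toReal _ (S := Finset.univ) (by simp), gapDensity, Finset.sum_div]
  refine Finset.sum_congr rfl fun r _ => ?_
  rw [PMF.uniformOfFintype_apply, indep_apply, ENNReal.toReal_prod]
  simp only [survivors_toReal, Fintype.card_fin]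
  rw [ENNReal.toReal_inv, ENNReal.toReal_natCast, div_eq_inv_mul]
  push_cast
  rfl

theorem gapLaw_eq_zero {k N : ℕ} {a : Fin (k + 1) → ℕ} (ha : ∀ j, a j ≤ N)
    (b : Fin (k + 1) → ℕ) (hb : b ∉ Fintype.piFinset fun _ : Fin (k + 1) => Finset.range (N + 1)) :
    gapLaw p a b = 0 := by
  obtain ⟨j, hj⟩ : ∃ j, N < b j := by simpa [Fintype.mem_piFinset, Nat.lt_succ_iff] using hb
  have h : (gapLaw p a b).toReal = 0 := by
    rw [gapLaw_toReal, gapDensity]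
    simp only [fun r => Finset.prod_eq_zero (f := fun j => binomWeight (p : ℝ) (1 - p) (a (j + r))
      (b j)) (Finset.mem_univ j) (binomWeight_eq_zero ((ha (j + r)).trans_lt hj)),
      Finset.sum_const_zero, zero_div]
  exact ((ENNReal.toReal_eq_zero_iff _).1 h).resolve_right (PMF.apply_ne_top _ _)

end Law

end CircularTrace

/-! ### The lower bound on the number of traces -/

theorem mainTheorem3 (p : unitInterval) (hp0 : 0 < p) (hp1 : p < 1)
    (k : ℕ) (hk : 1 ≤ k) (z : ℕ) (M : ℕ) :
    ∃ c : ℝ, 0 < c ∧ ∃ N : ℕ, ∀ x y : Fin k → ℤ,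
      (∀ j, |x j| ≤ (M : ℤ)) →
      (∃ σ : Equiv.Perm (Fin k), y = x ∘ σ) →
      CircularTrace.SameCyclicStats z x y →
      ∀ n : ℕ, N ≤ n → ∀ (T : ℕ) (A : CircularTrace.Algorithm T),
        CircularTrace.Distinguishes A
          (CircularTrace.Del p (CircularTrace.shiftedString n x))
          (CircularTrace.Del p (CircularTrace.shiftedString n y)) →
        c * ((n : ℝ) ^ (z + 1) / Real.log (n : ℝ) ^ (z + 1)) ≤ (T : ℝ) := by
  open CircularTrace in
  obtain ⟨k, rfl⟩ : ∃ k', k = k' + 1 := ⟨k - 1, by omega⟩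
  have hp0' : (0 : ℝ) < p := hp0
  have hp1' : (p : ℝ) < 1 := hp1
  obtain ⟨C, hC, hH⟩ := exists_hellinger_gapDensity_le hp0' (sub_pos.2 hp1')
    (add_sub_cancel (p : ℝ) 1) k (2 * M) z
  -- The constant solves `1/9 ≤ T * C * (2/n)^(z+1)` for `T`. The threshold gives `n ≤ 2 (n - M)`
  -- and `n ≥ 3 > e`.
  refine ⟨1 / (9 * C * 2 ^ (z + 1)), by positivity, 2 * M + 3, ?_⟩
  rintro x _ hx ⟨σ, rfl⟩ hstat n hn T A hA
  have hy : ∀ j, |(x ∘ σ) j| ≤ (M : ℤ) := fun j => hx (σ j)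
  -- The gaps become `m + (xⱼ + M)`, with natural offsets at most `D = 2 * M`.
  obtain ⟨m, rfl⟩ : ∃ m, n = m + M := ⟨n - M, by omega⟩
  have hshift : ∀ w : Fin (k + 1) → ℤ, (∀ j, |w j| ≤ (M : ℤ)) →
      shiftedString (m + M) w = gapString fun j => m + (w j + M).toNat := by
    intro w hw
    rw [shiftedString]
    congr 1
    funext j
    have := neg_le_of_abs_le (hw j)
    omega
  have hle : ∀ w : Fin (k + 1) → ℤ, (∀ j, |w j| ≤ (M : ℤ)) → ∀ j, (w j + M).toNat ≤ 2 * M := by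
    intro w hw j
    have := le_of_abs_le (hw j)
    omega
  rw [hshift x hx, hshift _ hy, Del_gapString, Del_gapString] at hA
  obtain ⟨B, hB1, hB2⟩ := exists_distinguishing_of_bind A _ _ _ hA
  have htest := one_le_mul_hellinger _ _
    (Fintype.piFinset fun _ : Fin (k + 1) => Finset.range (m + 2 * M + 1))
    (gapLaw_eq_zero p fun j => Nat.add_le_add_left (hle x hx j) m)
    (gapLaw_eq_zero p fun j => Nat.add_le_add_left (hle _ hy j) m) B hB1 hB2
  simp only [gapLaw_toReal] at htest
  have hm : 0 < m := by omega
  have hell := hH m hm _ _ (hle x hx) (hle _ hy) (sum_prod_choose_eq hstat hx hy)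
  have hm' : (0 : ℝ) < m := by exact_mod_cast hm
  have hn' : (0 : ℝ) < ((m + M : ℕ) : ℝ) := by exact_mod_cast (by omega : 0 < m + M)
  have hmn : (1 / m : ℝ) ≤ 2 / ((m + M : ℕ) : ℝ) := by
    rw [div_le_div_iff₀ hm' hn', one_mul]
    exact_mod_cast (by omega : m + M ≤ 2 * m)
  have hpow : (1 / m : ℝ) ^ (z + 1) ≤ 2 ^ (z + 1) / ((m + M : ℕ) : ℝ) ^ (z + 1) := by
    rw [← div_pow]
    gcongr
  have hT : (1 : ℝ) / 9 ≤ T * (C * (2 ^ (z + 1) / ((m + M : ℕ) : ℝ) ^ (z + 1))) :=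
    htest.trans (mul_le_mul_of_nonneg_left
      (hell.trans (mul_le_mul_of_nonneg_left hpow hC.le)) (Nat.cast_nonneg T))
  -- The argument yields order `n^(z+1)` without logarithms; dividing by powers of `log n ≥ 1` only
  -- weakens it.
  have hlog : 1 ≤ Real.log ((m + M : ℕ) : ℝ) := by
    rw [Real.le_log_iff_exp_le hn']
    have h3 : (3 : ℝ) ≤ ((m + M : ℕ) : ℝ) := by exact_mod_cast (by omega : 3 ≤ m + M)
    linarith [Real.exp_one_lt_d9]
  refine (mul_le_mul_of_nonneg_left (div_le_self (by positivity) (one_le_pow₀ hlog))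
    (by positivity)).trans ?_
  rw [one_div_mul_eq_div, div_le_iff₀ (by positivity)]
  rw [← mul_div_assoc, ← mul_div_assoc, le_div_iff₀ (by positivity)] at hT
  linarith
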